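/- Let $F$ be a finite field and let $C\subseteq F^n$ be a linear code. For $S\subseteq\{1,\dots,n\}$ let $C_S$ be the projection of $C$ to the coordinates in $S$, and let $d(\cdot)$ denote the minimum Hamming distance between distinct codewords (defined for codes with at least two words). A set $S$ is an $(r,\delta)$-locality set of $C$ if $|S|\le r+\delta-1$, $C_S\neq\{0\}$ and $d(C_S)\ge\delta$. A linear LRC with parameters $(n,k,r,\delta)$ is a linear code of length $n$ and dimension $k$ over some finite field such that every coordinate $l\in\{1,\dots,n\}$ lies in an $(r,\delta)$-locality set. Let $d_{\max}=d_{\max}(n,k,r,\delta)$ be the largest minimum distance of a linear LRC with parameters $(n,k,r,\delta)$, over all finite fields. **Theorem.** Let $n,k,r,\delta$ be integers with $0<r<k\le n-\lceil k/r\rceil(\delta-1)$ and $\delta\ge 2$. Put $$a=r\lceil k/r\rceil-k,\qquad b=(r+\delta-1)\left\lceil\tfrac{n}{r+\delta-1}\right\rceil-n,\qquad m=\left\lceil\tfrac{n}{r+\delta-1}\right\rceil-1,$$ $$v=r+\delta-1-b-\left\lfloor\tfrac{r+\delta-1-b}{m}\right\rfloor m,$$ and suppose that $b>a$. Then linear LRCs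 with parameters $(n,k,r,\delta)$ exist (so $d_{\max}$ is well defined), and the following hold. 1. If $\delta-1\le(\lceil k/r\rceil-1)\left\lfloor\tfrac{r+\delta-1-b}{m}\right\rfloor+\min\{v,\lceil k/r\rceil-1\}$, then $$d_{\max}\ge n-k+1-\lceil k/r\rceil(\delta-1).$$ 2. Otherwise, $d_{\max}\ge d_{\rm new}$, where $$d_{\rm new}=n-k+1-\min\{v,\lceil k/r\rceil-1\}-(\lceil k/r\rceil-1)\left(\left\lfloor\tfrac{r+\delta-1-b}{m}\right\rfloor+\delta-1\right).$$ 3. In either case, with $d_{\rm old}=n-k+1-\lceil k/r\rceil(\delta-1)+(b-r)$, $$d_{\rm new}-d_{\rm old}\ge\left\lfloor\tfrac{r+\delta-1-b}{m}\right\rfloor\left(m-\lceil k/r\rceil+1\right)\ge 0.$$ -/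

import Mathlib

/-- The projection `C_S` of a code `C` to the coordinates in `S`. -/
def codeProjection {ι F : Type} (C : Set (ι → F)) (S : Finset ι) : Set (S → F) :=
  (fun c (i : S) => c i) '' C

open Classical in
/-- The minimum Hamming distance between two distinct codewords of `C`.
A code with fewer than two words has no minimum distance; the value is then `0`,
so that such a code never counts as having minimum distance at least `δ ≥ 1`. -/
noncomputable def codeMinDist {ι F : Type} [Fintype ι] (C : Set (ι → F)) : ℕ :=
  sInf {d : ℕ | ∃ x ∈ C, ∃ y ∈ C, x ≠ y ∧ hammingDist x y = d}

/-- `S` is an `(r, δ)`-locality set of `C`: `|S| ≤ r + δ - 1` and `d(C_S) ≥ δ`. -/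
def IsLocalitySet {ι F : Type} (C : Set (ι → F)) (r δ : ℕ) (S : Finset ι) : Prop :=
  S.card ≤ r + δ - 1 ∧ δ ≤ codeMinDist (codeProjection C S)

/-- All-symbol locality `(r, δ)`: every coordinate lies in an `(r, δ)`-locality set. -/
def HasAllSymbolLocality {ι F : Type} (C : Set (ι → F)) (r δ : ℕ) : Prop :=
  ∀ l : ι, ∃ S : Finset ι, l ∈ S ∧ IsLocalitySet C r δ S

/-- The minimum distances of all linear locally repairable codes with parameters
`(n, k, r, δ)`: linear codes of length `n` and dimension `k` over a finite field,
with all-symbol locality `(r, δ)`. The finite field is arbitrary. -/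
def linearLRCDistances (n k r δ : ℕ) : Set ℕ :=
  {d : ℕ | ∃ (F : Type) (_ : Field F) (_ : Finite F) (C : Submodule F (Fin n → F)),
    Module.finrank F C = k ∧ HasAllSymbolLocality (C : Set (Fin n → F)) r δ ∧
      codeMinDist (C : Set (Fin n → F)) = d}

/-- The maximal minimum distance of a linear LRC with parameters `(n, k, r, δ)`. -/
noncomputable def linearLRCDMax (n k r δ : ℕ) : ℕ :=
  sSup (linearLRCDistances n k r δ)

/-! Split the coordinates into clusters of sizes `s i`, give each a Reed–Solomon code of dimension
`ρ i ≤ r`, and take a generic `k`-dimensional subcode of the direct sum. Over a large field no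
nonzero codeword vanishes on a `k`-set meeting each cluster in at most `ρ i` points
(`exists_generic_subcode`). The zero set of a nonzero codeword thus has rank below `k` in the
partition matroid with capacities `ρ`; beyond that rank it contains only the surplus in a family `J`
of filled clusters with `∑ ρ i < k`. So the distance is at least `n - k + 1` minus the largest `∑ (s
i - ρ i)` over such `J` (`exists_mem_linearLRCDistances`).

Two layouts suffice: `m` nearly equal clusters of dimension `r` give the new bound; for `b < r`, `m`
clusters of size `r + δ - 1` and a short one of dimension `r - b` give the bound of case 1. For `b ≥
r` the comparison with the old bound settles case 1. -/

open Finset Polynomial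
open scoped Pointwise

/-! ### Subspaces avoiding finitely many given ones -/

section CommonComplement

variable {F V : Type*} [Field F] [AddCommGroup V] [Module F V]

/-- A vector space is not a union of fewer than `|F|` many proper subspaces. -/
theorem exists_forall_notMem_of_card_lt {ι : Type*} (s : Finset ι) (hs : s.card < Nat.card F)
    (W : ι → Submodule F V) (hW : ∀ i ∈ s, W i ≠ ⊤) : ∃ x, ∀ i ∈ s, x ∉ W i := by
  by_contra! h
  -- By B. H. Neumann's lemma on coset covers, some `W i` has index at most `#s`; but a nonzero
  -- quotient has at least `|F|` elements.
  have hcov : ⋃ i ∈ s, (0 : V) +ᵥ ((W i).toAddSubgroup : Set V) = Set.univ := by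
    simp only [zero_vadd, Set.eq_univ_iff_forall, Set.mem_iUnion]
    intro x
    obtain ⟨i, hi, hx⟩ := h x
    exact ⟨i, hi, hx⟩
  obtain ⟨i, hi, hfin, hle⟩ := AddSubgroup.exists_index_le_card_of_leftCoset_cover hcov
  obtain ⟨x, hx⟩ : ∃ x, x ∉ W i := by
    by_contra! hx
    exact hW i hi (Submodule.eq_top_iff'.2 hx)
  have : Finite (V ⧸ W i) := AddSubgroup.finite_quotient_of_finiteIndex (H := (W i).toAddSubgroup)
  have hinj : Function.Injective fun c : F => c • (Submodule.Quotient.mk x : V ⧸ W i) :=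
    smul_left_injective F (by rwa [ne_eq, Submodule.Quotient.mk_eq_zero])
  have h1 := Nat.card_le_card_of_injective _ hinj
  have h2 : Nat.card (V ⧸ W i) = (W i).toAddSubgroup.index := rfl
  omega

/-- Few subspaces of codimension at least `k` miss a common `k`-dimensional subspace. -/
theorem exists_finrank_eq_forall_disjoint [FiniteDimensional F V] {ι : Type*} (s : Finset ι)
    (hne : s.Nonempty) (hs : s.card < Nat.card F) (k : ℕ) (W : ι → Submodule F V)
    (hW : ∀ i ∈ s, Module.finrank F (W i) + k ≤ Module.finrank F V) :
    ∃ C : Submodule F V, Module.finrank F C = k ∧ ∀ i ∈ s, Disjoint C (W i) := by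
  induction k generalizing W with
  | zero => exact ⟨⊥, finrank_bot F V, fun i _ => disjoint_bot_left⟩
  | succ k ih =>
    obtain ⟨x, hx⟩ := exists_forall_notMem_of_card_lt s hs W fun i hi h => by
      have := hW i hi
      rw [h, finrank_top] at this
      omega
    obtain ⟨i₀, hi₀⟩ := hne
    have hx0 : x ≠ 0 := fun h => hx i₀ hi₀ (h ▸ zero_mem _)
    -- Avoiding the enlarged spaces `W i ⊔ F ∙ x` leaves room to add `x` to `C` afterwards.
    obtain ⟨C, hC, hd⟩ := ih (fun i => W i ⊔ F ∙ x) fun i hi => by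
      have h1 := Submodule.finrank_add_le_finrank_add_finrank (W i) (F ∙ x)
      have h2 := finrank_span_singleton (K := F) hx0
      have := hW i hi
      omega
    refine ⟨C ⊔ F ∙ x, ?_, fun i hi => ?_⟩
    · have h1 := Submodule.finrank_sup_add_finrank_inf_eq C (F ∙ x)
      rw [((hd i₀ hi₀).mono_right le_sup_right).eq_bot, finrank_bot,
        finrank_span_singleton (K := F) hx0, hC] at h1
      exact h1
    · rw [Submodule.disjoint_def]
      intro y hy hyW
      obtain ⟨c, hc, z, hz, rfl⟩ := Submodule.mem_sup.1 hy
      have hc0 : c = 0 := Submodule.disjoint_def.1 (hd i hi) c hc <| by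
        have := Submodule.sub_mem _ (Submodule.mem_sup_left hyW : _ ∈ W i ⊔ F ∙ x)
          (Submodule.mem_sup_right hz)
        simpa using this
      obtain ⟨a, rfl⟩ := Submodule.mem_span_singleton.1 hz
      subst hc0
      rw [zero_add] at hyW ⊢
      by_contra hne
      have ha : a ≠ 0 := fun h => hne (by simp [h])
      exact hx i hi ((Submodule.smul_mem_iff _ ha).1 hyW)

end CommonComplement

/-! ### Partition matroid of the clusters -/

section Clusters

variable {ι κ : Type} [DecidableEq κ]

/-- `T` meets every fibre of `g` in at most as many points as `ρ` allows. -/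
def FibreBounded (g : ι → κ) (ρ : κ → ℕ) (T : Finset ι) : Prop :=
  ∀ i, #{x ∈ T | g x = i} ≤ ρ i

theorem FibreBounded.mono {g : ι → κ} {ρ : κ → ℕ} {S T : Finset ι} (hT : FibreBounded g ρ T)
    (h : S ⊆ T) : FibreBounded g ρ S :=
  fun i => (card_le_card (filter_subset_filter _ h)).trans (hT i)

/-- Independent sets of a partition matroid extend to bases of `A`, fibre by fibre; the sum is the
rank of `A`. -/
theorem FibreBounded.exists_between {g : ι → κ} {ρ : κ → ℕ} {A₀ A : Finset ι} [Fintype κ]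
    [DecidableEq ι]
    (h₀ : FibreBounded g ρ A₀) (h : A₀ ⊆ A) :
    ∃ B, A₀ ⊆ B ∧ B ⊆ A ∧ FibreBounded g ρ B ∧
      #B = ∑ i, min (#{x ∈ A | g x = i}) (ρ i) := by
  choose B hB₀ hB hcard using fun i => exists_subsuperset_card_eq
    (filter_subset_filter (fun x => g x = i) h)
    (le_min (card_le_card (filter_subset_filter _ h)) (h₀ i)) (min_le_left _ _)
  have hfib : ∀ i, {x ∈ univ.biUnion B | g x = i} = B i := by
    intro i
    ext x
    simp only [mem_filter, mem_biUnion, mem_univ, true_and]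
    constructor
    · rintro ⟨⟨j, hj⟩, rfl⟩
      rwa [(mem_filter.1 (hB j hj)).2]
    · exact fun hx => ⟨⟨i, hx⟩, (mem_filter.1 (hB i hx)).2⟩
  refine ⟨univ.biUnion B, fun x hx => ?_, fun x hx => ?_, fun i => ?_, ?_⟩
  · exact mem_biUnion.2 ⟨g x, mem_univ _, hB₀ _ (by simp [hx])⟩
  · obtain ⟨i, _, hi⟩ := mem_biUnion.1 hx
    exact (mem_filter.1 (hB i hi)).1
  · rw [hfib, hcard]
    exact min_le_right _ _
  · rw [card_eq_sum_card_fiberwise (f := g) (t := univ) (by simp)]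
    simp only [hfib, hcard]

/-- A set without fibre-bounded subsets of size `k` has fewer than `k` points outside the surplus
of the fibres that it overfills, and these have total bound less than `k`. -/
theorem card_lt_of_forall_fibreBounded {g : ι → κ} {ρ : κ → ℕ} {A : Finset ι} [Fintype κ]
    [Fintype ι] [DecidableEq ι] {k : ℕ} (hA : ∀ T ⊆ A, FibreBounded g ρ T → #T ≠ k) :
    ∃ J : Finset κ, ∑ i ∈ J, ρ i < k ∧ #A < k + ∑ i ∈ J, (#{x | g x = i} - ρ i) := by
  obtain ⟨B, -, hBA, hB, hcard⟩ :=
    FibreBounded.exists_between (g := g) (ρ := ρ) (A₀ := ∅) (A := A) (fun i => by simp) (by simp)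
  have hlt : #B < k := by
    by_contra! hk
    obtain ⟨T, hTB, hT⟩ := exists_subset_card_eq hk
    exact hA T (hTB.trans hBA) (hB.mono hTB) hT
  refine ⟨({i | ρ i ≤ #{x ∈ A | g x = i}} : Finset κ), ?_, ?_⟩
  · refine lt_of_le_of_lt ?_ (hcard ▸ hlt)
    refine (sum_le_sum fun i hi => ?_).trans
      (sum_le_sum_of_subset (filter_subset (fun i => ρ i ≤ #{x ∈ A | g x = i}) univ))
    exact le_min (mem_filter.1 hi).2 le_rfl
  · have hsum : #A = #B + ∑ i, (#{x ∈ A | g x = i} - ρ i) := by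
      rw [hcard, ← sum_add_distrib,
        card_eq_sum_card_fiberwise (s := A) (f := g) (t := univ) (by simp)]
      exact sum_congr rfl fun i _ => by omega
    have hle : ∑ i, (#{x ∈ A | g x = i} - ρ i) ≤
        ∑ i with ρ i ≤ #{x ∈ A | g x = i}, (#{x | g x = i} - ρ i) := by
      rw [sum_filter]
      refine sum_le_sum fun i _ => ?_
      have := card_le_card (filter_subset_filter (fun x => g x = i) (subset_univ A))
      split_ifs <;> omega
    omega

/-- Any sizes adding up to `n` are the fibre sizes of a function on `Fin n`. -/
theorem exists_card_fibre_eq {n t : ℕ} (s : Fin t → ℕ) (hs : ∑ i, s i = n) :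
    ∃ g : Fin n → Fin t, ∀ i, #{x | g x = i} = s i := by
  subst hs
  refine ⟨fun x => (finSigmaFinEquiv.symm x).1, fun i => ?_⟩
  rw [← Fintype.card_subtype, Fintype.card_congr
    ((finSigmaFinEquiv (n := s)).symm.subtypeEquiv (q := fun y => y.1 = i) fun _ => Iff.rfl),
    Fintype.card_congr (Equiv.sigmaSubtype i), Fintype.card_fin]

end Clusters

/-! ### Sums of Reed–Solomon codes and their generic subcodes -/

section Evaluation

variable {ι κ F : Type} [Field F]

/-- Evaluation at the points `α` of a family of polynomials, one for each fibre of `g`, with the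
degree of the polynomial at `i` below `ρ i`. -/
noncomputable def clusterEval (g : ι → κ) (ρ : κ → ℕ) (α : ι → F) :
    (∀ i, degreeLT F (ρ i)) →ₗ[F] (ι → F) :=
  LinearMap.pi fun x => leval (α x) ∘ₗ (degreeLT F (ρ (g x))).subtype ∘ₗ LinearMap.proj (g x)

@[simp]
theorem clusterEval_apply (g : ι → κ) (ρ : κ → ℕ) (α : ι → F) (f : ∀ i, degreeLT F (ρ i))
    (x : ι) : clusterEval g ρ α f x = (f (g x) : F[X]).eval (α x) := rfl

theorem exists_clusterEval_eq [DecidableEq ι] [DecidableEq κ] {g : ι → κ} {ρ : κ → ℕ} {α : ι → F}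
    (hα : Function.Injective α) {T : Finset ι} (hT : FibreBounded g ρ T) (u : ι → F) :
    ∃ f, ∀ x ∈ T, clusterEval g ρ α f x = u x := by
  refine ⟨fun i => ⟨Lagrange.interpolate {x ∈ T | g x = i} α u, mem_degreeLT.2 ?_⟩,
    fun x hx => ?_⟩
  · exact (Lagrange.degree_interpolate_lt _ hα.injOn).trans_le (by exact_mod_cast hT i)
  · exact Lagrange.eval_interpolate_at_node _ hα.injOn (by simp [hx])

/-- A word of the evaluation code vanishes on a fibre once it has `ρ i` zeros there. -/
theorem clusterEval_eq_zero_of_card_le {g : ι → κ} {ρ : κ → ℕ} {α : ι → F}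
    (hα : Function.Injective α) {c : ι → F} (hc : c ∈ LinearMap.range (clusterEval g ρ α))
    {A : Finset ι} {i : κ} (hA : ∀ x ∈ A, g x = i ∧ c x = 0) (hcard : ρ i ≤ #A) {y : ι}
    (hy : g y = i) : c y = 0 := by
  obtain ⟨f, rfl⟩ := hc
  have h0 : (f i : F[X]) = 0 := by
    refine eq_zero_of_degree_lt_of_eval_index_eq_zero A hα.injOn ?_ fun x hx => ?_
    · exact (mem_degreeLT.1 (f i).2).trans_le (by exact_mod_cast hcard)
    · obtain ⟨rfl, h⟩ := hA x hx
      exact h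
  subst hy
  simp [h0]

/-- By interpolation, restriction to each such `T` is onto, so its kernel has codimension `k`. There
are at most `2 ^ |ι|` kernels, so a common `k`-dimensional subspace misses them all. -/
theorem exists_generic_subcode [Fintype ι] [DecidableEq ι] [Fintype κ] [DecidableEq κ]
    {g : ι → κ} {ρ : κ → ℕ} {α : ι → F} (hα : Function.Injective α)
    (hF : 2 ^ Fintype.card ι < Nat.card F) {k : ℕ}
    (hk : ∃ T : Finset ι, FibreBounded g ρ T ∧ #T = k) :
    ∃ C ≤ LinearMap.range (clusterEval g ρ α), Module.finrank F C = k ∧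
      ∀ T : Finset ι, FibreBounded g ρ T → #T = k → ∀ c ∈ C, (∀ x ∈ T, c x = 0) → c = 0 := by
  classical
  have hfd : ∀ i, FiniteDimensional F (degreeLT F (ρ i)) := fun i =>
    (degreeLTEquiv F (ρ i)).symm.finiteDimensional
  let R (T : Finset ι) : (∀ i, degreeLT F (ρ i)) →ₗ[F] (T → F) :=
    LinearMap.funLeft F F Subtype.val ∘ₗ clusterEval g ρ α
  let s : Finset (Finset ι) := {T | FibreBounded g ρ T ∧ #T = k}
  obtain ⟨C, hC, hd⟩ := exists_finrank_eq_forall_disjoint (F := F) s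
    (by obtain ⟨T, hT⟩ := hk; exact ⟨T, by simp [s, hT]⟩)
    (lt_of_le_of_lt ((card_le_univ s).trans (by simp)) hF) k (fun T => LinearMap.ker (R T)) (by
      intro T hT
      simp only [s, mem_filter, mem_univ, true_and] at hT
      have hsurj : LinearMap.range (R T) = ⊤ := by
        rw [LinearMap.range_eq_top]
        intro u
        obtain ⟨f, hf⟩ := exists_clusterEval_eq hα hT.1
          (fun x => if h : x ∈ T then u ⟨x, h⟩ else 0)
        refine ⟨f, funext fun x => ?_⟩
        have := hf x x.2
        simpa [R, LinearMap.funLeft_apply] using this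
      have h1 := LinearMap.finrank_range_add_finrank_ker (R T)
      rw [hsurj, finrank_top, Module.finrank_fintype_fun_eq_card, Fintype.card_coe, hT.2] at h1
      omega)
  have key : ∀ T : Finset ι, FibreBounded g ρ T → #T = k → ∀ f ∈ C,
      (∀ x ∈ T, clusterEval g ρ α f x = 0) → f = 0 := by
    intro T hT hTk f hf h0
    refine Submodule.disjoint_def.1 (hd T (by simp [s, hT, hTk])) f hf ?_
    exact LinearMap.mem_ker.2 (funext fun x => h0 x x.2)
  refine ⟨C.map (clusterEval g ρ α), LinearMap.map_le_range, ?_, ?_⟩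
  · obtain ⟨T, hT, hTk⟩ := hk
    have hinj : Function.Injective ((clusterEval g ρ α).domRestrict C) := by
      refine (injective_iff_map_eq_zero _).2 ?_
      rintro ⟨f, hf⟩ h0
      exact Subtype.ext (key T hT hTk f hf fun x _ => congrFun h0 x)
    rw [← LinearMap.range_domRestrict, LinearMap.finrank_range_of_inj hinj, hC]
  · rintro T hT hTk _ ⟨f, hf, rfl⟩ h0
    rw [key T hT hTk f hf h0, map_zero]

end Evaluation

/-! ### Bounds on the minimum distance -/

section MinDist

variable {ι F : Type} [Fintype ι]

open Classical in
theorem le_codeMinDist {C : Set (ι → F)} {d : ℕ} (hC : ∃ x ∈ C, ∃ y ∈ C, x ≠ y)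
    (h : ∀ x ∈ C, ∀ y ∈ C, x ≠ y → d + #{i | x i = y i} ≤ Fintype.card ι) :
    d ≤ codeMinDist C := by
  obtain ⟨x, hx, y, hy, hxy⟩ := hC
  refine le_csInf ⟨_, x, hx, y, hy, hxy, rfl⟩ ?_
  rintro _ ⟨x, hx, y, hy, hxy, rfl⟩
  have h1 := h x hx y hy hxy
  have h2 := card_filter_add_card_filter_not (s := (univ : Finset ι)) (fun i => x i = y i)
  rw [card_univ] at h2
  have h3 : hammingDist x y = #{i | ¬ x i = y i} := by
    unfold hammingDist
    congr
  omega

open Classical in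
theorem codeMinDist_le_card (C : Set (ι → F)) : codeMinDist C ≤ Fintype.card ι := by
  unfold codeMinDist
  rcases Set.eq_empty_or_nonempty
    {d : ℕ | ∃ x ∈ C, ∃ y ∈ C, x ≠ y ∧ hammingDist x y = d} with h | h
  · simp [h]
  · obtain ⟨x, -, y, -, -, hxy⟩ := Nat.sInf_mem h
    rw [← hxy]
    exact hammingDist_le_card_fintype

end MinDist

theorem isGreatest_linearLRCDMax {n k r δ : ℕ} (h : (linearLRCDistances n k r δ).Nonempty) :
    IsGreatest (linearLRCDistances n k r δ) (linearLRCDMax n k r δ) := by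
  have hbdd : BddAbove (linearLRCDistances n k r δ) := by
    refine ⟨n, ?_⟩
    rintro _ ⟨F, _, _, C, -, -, rfl⟩
    simpa using codeMinDist_le_card (C : Set (Fin n → F))
  exact ⟨Nat.sSup_mem h hbdd, fun d hd => le_csSup hbdd hd⟩

/-! ### Locality and distance of the generic subcode -/

section Construction

variable {n k r δ t : ℕ}

/-- A code all of whose words vanishing on `T` are zero takes arbitrary values on `T` if `#T` is
the dimension of the code. -/
theorem exists_mem_ne_zero_of_finrank_eq {ι F : Type} [Finite ι] [Field F]
    {C : Submodule F (ι → F)} {T : Finset ι} (hC : Module.finrank F C = #T)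
    (hT : ∀ c ∈ C, (∀ x ∈ T, c x = 0) → c = 0) {l : ι} (hl : l ∈ T) : ∃ c ∈ C, c l ≠ 0 := by
  classical
  let R : C →ₗ[F] (T → F) := LinearMap.funLeft F F Subtype.val ∘ₗ C.subtype
  have hinj : Function.Injective R := LinearMap.ker_eq_bot.1 <| LinearMap.ker_eq_bot'.2 <| by
    rintro ⟨c, hc⟩ h0
    exact Subtype.ext (hT c hc fun x hx => congrFun h0 ⟨x, hx⟩)
  have hsurj : Function.Surjective R :=
    (LinearMap.injective_iff_surjective_of_finrank_eq_finrank (by simp [hC])).1 hinj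
  obtain ⟨c, hc⟩ := hsurj 1
  refine ⟨c, c.2, ?_⟩
  have h1 : (c : ι → F) l = 1 := congrFun hc ⟨l, hl⟩
  simp [h1]

/-- A subcode of the evaluation code that does not vanish at `l` has a locality set inside the
fibre of `l`. -/
theorem exists_isLocalitySet_of_le_range_clusterEval {ι κ F : Type} [Fintype ι] [DecidableEq ι]
    [DecidableEq κ] [Field F] {g : ι → κ} {ρ : κ → ℕ} {α : ι → F} (hα : Function.Injective α)
    {C : Submodule F (ι → F)} (hC : C ≤ LinearMap.range (clusterEval g ρ α)) (hδ : 1 ≤ δ)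
    {l : ι} (hρ : 0 < ρ (g l)) (hρr : ρ (g l) ≤ r) (hsize : ρ (g l) + δ ≤ #{x | g x = g l} + 1)
    (hl : ∃ c ∈ C, c l ≠ 0) : ∃ S : Finset ι, l ∈ S ∧ IsLocalitySet (C : Set (ι → F)) r δ S := by
  classical
  -- A fibre may exceed `r + δ - 1` points; as `ρ (g l) ≤ r`, truncating it there keeps distance
  -- `δ`.
  obtain ⟨S, hlS, hS, hcard⟩ := exists_subsuperset_card_eq
    (s := {l}) (t := ({x | g x = g l} : Finset ι)) (n := min #{x | g x = g l} (r + δ - 1))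
    (by simp) (by rw [card_singleton]; omega) (min_le_left _ _)
  refine ⟨S, by simpa using hlS, hcard ▸ min_le_right _ _, le_codeMinDist ?_ ?_⟩
  · obtain ⟨c, hc, hcl⟩ := hl
    refine ⟨_, ⟨c, hc, rfl⟩, _, ⟨0, C.zero_mem, rfl⟩, fun h => hcl ?_⟩
    exact congrFun h ⟨l, by simpa using hlS⟩
  · rintro _ ⟨c, hc, rfl⟩ _ ⟨c', hc', rfl⟩ hne
    have hlt : #{i : S | c i = c' i} < ρ (g l) := by
      by_contra! hle
      refine hne (funext fun y => sub_eq_zero.1 ?_)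
      refine clusterEval_eq_zero_of_card_le hα (hC (C.sub_mem hc hc'))
        (A := ({i : S | c i = c' i} : Finset S).map (Function.Embedding.subtype _))
        (i := g l) ?_ (by rwa [card_map]) (mem_filter.1 (hS y.2)).2
      intro x hx
      obtain ⟨z, hz, rfl⟩ := mem_map.1 hx
      exact ⟨(mem_filter.1 (hS z.2)).2, sub_eq_zero.2 (mem_filter.1 hz).2⟩
    rw [Fintype.card_coe, hcard]
    have : #{i : S | c i = c' i} + 1 ≤ ρ (g l) := hlt
    have hmin : ρ (g l) + δ ≤ min #{x | g x = g l} (r + δ - 1) + 1 := by omega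
    convert (show δ + #{i : S | c i = c' i} ≤ min #{x | g x = g l} (r + δ - 1) by omega) using 1

/-- Clusters of sizes `s i` that carry MDS codes of dimensions `ρ i ≤ r` and distances at least
`δ` give, through a generic subcode of their direct sum, a locally repairable code. -/
theorem exists_mem_linearLRCDistances (hk : 0 < k) (hδ : 1 ≤ δ) (s ρ : Fin t → ℕ)
    (hs : ∑ i, s i = n) (hρ : ∀ i, 0 < ρ i) (hρr : ∀ i, ρ i ≤ r)
    (hsize : ∀ i, ρ i + δ ≤ s i + 1) (hsum : k ≤ ∑ i, ρ i) (D : ℤ)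
    (hD : ∀ J : Finset (Fin t), ∑ i ∈ J, ρ i < k → D + k + ∑ i ∈ J, (s i - ρ i) ≤ n + 1) :
    ∃ d ∈ linearLRCDistances n k r δ, D ≤ d := by
  classical
  obtain ⟨g, hg⟩ := exists_card_fibre_eq s hs
  obtain ⟨p, hpn, hp⟩ := Nat.exists_infinite_primes (2 ^ n + 1)
  have : Fact p.Prime := ⟨hp⟩
  have hnp : n < p := n.lt_two_pow_self.trans hpn
  have hα : Function.Injective fun x : Fin n => ((x : ℕ) : ZMod p) := fun x y h => by
    rw [ZMod.natCast_eq_natCast_iff', Nat.mod_eq_of_lt (x.2.trans hnp),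
      Nat.mod_eq_of_lt (y.2.trans hnp)] at h
    exact Fin.ext h
  have hT : ∀ A₀ : Finset (Fin n), FibreBounded g ρ A₀ → #A₀ ≤ k →
      ∃ T, A₀ ⊆ T ∧ FibreBounded g ρ T ∧ #T = k := by
    intro A₀ h₀ hle
    obtain ⟨B, hAB, -, hB, hcard⟩ := h₀.exists_between (subset_univ _)
    have hkB : k ≤ #B := by
      refine hsum.trans_eq (hcard.symm ▸ sum_congr rfl fun i _ => ?_)
      have := hsize i
      rw [hg, min_eq_right (by omega)]
    obtain ⟨T, hAT, hTB, hTk⟩ := exists_subsuperset_card_eq hAB hle hkB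
    exact ⟨T, hAT, hB.mono hTB, hTk⟩
  obtain ⟨C, hCle, hCk, hC⟩ := exists_generic_subcode (F := ZMod p) (g := g) (ρ := ρ) hα
    (by simpa using hpn) (k := k) (by
      obtain ⟨T, -, hT⟩ := hT ∅ (fun i => by simp) (by simp)
      exact ⟨T, hT⟩)
  have hne : ∀ l, ∃ c ∈ C, c l ≠ 0 := fun l => by
    obtain ⟨T, hlT, hTb, hTk⟩ := hT {l} (fun i => (card_filter_le _ _).trans (hρ i)) hk
    exact exists_mem_ne_zero_of_finrank_eq (hCk.trans hTk.symm) (hC T hTb hTk)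
      (singleton_subset_iff.1 hlT)
  refine ⟨codeMinDist (C : Set (Fin n → ZMod p)), ⟨ZMod p, inferInstance, inferInstance, C, hCk,
    fun l => exists_isLocalitySet_of_le_range_clusterEval hα hCle hδ (hρ _) (hρr _)
      (by rw [hg]; exact hsize _) (hne l), rfl⟩, ?_⟩
  -- `D` may be negative, in which case only the trivial bound by `n` is needed.
  rw [← Int.toNat_le]
  refine le_codeMinDist ?_ fun x hx y hy hxy => ?_
  · have : Nontrivial C := Module.nontrivial_of_finrank_pos (R := ZMod p) (hCk ▸ hk)
    obtain ⟨x, y, hxy⟩ := exists_pair_ne C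
    exact ⟨x, x.2, y, y.2, fun h => hxy (Subtype.ext h)⟩
  · obtain ⟨J, hJ, hlt⟩ := card_lt_of_forall_fibreBounded (g := g) (ρ := ρ) (k := k)
      (A := {i | x i = y i}) (fun T hTA hTb hTk => hxy <| sub_eq_zero.1 <|
        hC T hTb hTk _ (C.sub_mem hx hy) fun z hz =>
          sub_eq_zero.2 (mem_filter.1 (hTA hz)).2)
    simp only [hg] at hlt
    have hle := hD J hJ
    have hcard := card_le_univ ({i | x i = y i} : Finset (Fin n))
    rw [Fintype.card_fin] at hcard ⊢
    have : D.toNat + #{i | x i = y i} ≤ n := by omega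
    convert this

end Construction

/-! ### The two cluster layouts -/

section Parameters

variable {n k r δ m K : ℕ}

/-- Clusters that all have dimension `r` and sizes as equal as possible. -/
theorem exists_mem_linearLRCDistances_of_equal_ranks {q v : ℕ} (hk : 0 < k) (hr : 0 < r)
    (hδ : 1 ≤ δ) (hkK : k ≤ r * K) (hKm : K ≤ m) (hvm : v ≤ m)
    (hn : m * (r + δ - 1 + q) + v = n) :
    ∃ d ∈ linearLRCDistances n k r δ,
      (n : ℤ) - k + 1 - min (v : ℤ) (K - 1) - (K - 1) * (q + δ - 1) ≤ d := by
  have hK : 0 < K := Nat.pos_of_ne_zero (by rintro rfl; omega)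
  refine exists_mem_linearLRCDistances (t := m) hk hδ
    (fun i => r + δ - 1 + q + if (i : ℕ) < v then 1 else 0) (fun _ => r) ?_ (fun _ => hr)
    (fun _ => le_rfl) (fun i => by omega) ?_ _ fun J hJ => ?_
  · rw [sum_add_distrib, sum_boole, sum_const, card_univ, Fintype.card_fin, smul_eq_mul,
      Fin.card_filter_val_lt, min_eq_right hvm, Nat.cast_id, hn]
  · rw [sum_const, card_univ, Fintype.card_fin, smul_eq_mul, mul_comm]
    exact hkK.trans (Nat.mul_le_mul_left r hKm)
  · rw [sum_const, smul_eq_mul, mul_comm] at hJ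
    have hJK : #J < K := lt_of_mul_lt_mul_left' (hJ.trans_le hkK)
    have hterm : ∀ i ∈ J, (r + δ - 1 + q + if (i : ℕ) < v then 1 else 0) - r =
        (q + δ - 1) + if (i : ℕ) < v then 1 else 0 := fun i _ => by omega
    rw [sum_congr rfl hterm, sum_add_distrib, sum_boole, sum_const, smul_eq_mul, Nat.cast_id]
    have h1 : #{i ∈ J | i.val < v} ≤ #J := card_filter_le _ _
    have h2 : #{i ∈ J | i.val < v} ≤ v := by
      refine (card_le_card (filter_subset_filter _ (subset_univ J))).trans ?_
      rw [Fin.card_filter_val_lt]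
      exact min_le_right _ _
    have h3 : #J * (q + δ - 1) ≤ (K - 1) * (q + δ - 1) := Nat.mul_le_mul_right _ (by omega)
    have h4 : (((K - 1) * (q + δ - 1) : ℕ) : ℤ) = ((K : ℤ) - 1) * (q + δ - 1) := by
      rw [Nat.cast_mul, Nat.cast_sub hK, Nat.cast_sub (by omega)]
      push_cast
      ring
    rw [← h4]
    have h5 : (#{i ∈ J | i.val < v} : ℤ) ≤ min (v : ℤ) (K - 1) := le_min (by omega) (by omega)
    omega

/-- Clusters of dimension `r` together with one cluster of a smaller dimension `e`, all of them
MDS of distance `δ`. -/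
theorem exists_mem_linearLRCDistances_of_short_cluster {e : ℕ} (hk : 0 < k) (hδ : 1 ≤ δ)
    (he : 0 < e) (her : e ≤ r) (hkK : k ≤ r * K) (hKm : K ≤ m)
    (hn : m * (r + δ - 1) + (e + δ - 1) = n) :
    ∃ d ∈ linearLRCDistances n k r δ, (n : ℤ) - k + 1 - K * (δ - 1) ≤ d := by
  have hK : 0 < K := Nat.pos_of_ne_zero (by rintro rfl; omega)
  let ρ : Fin (m + 1) → ℕ := Fin.snoc (fun _ : Fin m => r) e
  have hρ : ∀ i, 0 < ρ i ∧ ρ i ≤ r := fun i => by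
    induction i using Fin.lastCases with
    | last => simp [ρ, he, her]
    | cast i => simpa [ρ] using he.trans_le her
  refine exists_mem_linearLRCDistances (t := m + 1) hk hδ (fun i => ρ i + δ - 1) ρ ?_
    (fun i => (hρ i).1) (fun i => (hρ i).2) (fun i => by have := hρ i; omega) ?_ _ fun J hJ => ?_
  · simp [Fin.sum_univ_castSucc, ρ, hn]
  · simp only [Fin.sum_univ_castSucc, ρ, Fin.snoc_castSucc, Fin.snoc_last, sum_const, card_univ,
      Fintype.card_fin, smul_eq_mul]
    have := Nat.mul_le_mul_left r hKm
    rw [mul_comm] at this ⊢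
    nlinarith
  · have hJK : #J ≤ K := by
      -- Even without the short cluster, more than `K` clusters would leave `K` of dimension `r`,
      -- and `r * K ≥ k`.
      by_contra! hlt
      have h1 : K ≤ #(J.erase (Fin.last m)) := by
        have := pred_card_le_card_erase (s := J) (a := Fin.last m)
        omega
      have h2 : ∑ i ∈ J.erase (Fin.last m), ρ i = #(J.erase (Fin.last m)) * r := by
        rw [← smul_eq_mul, ← sum_const]
        refine sum_congr rfl fun i hi => ?_
        have hne := (mem_erase.1 hi).1
        induction i using Fin.lastCases with
        | last => exact absurd rfl hne
        | cast i => simp [ρ]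
      have h3 := sum_le_sum_of_subset (f := ρ) (erase_subset (Fin.last m) J)
      have h4 := Nat.mul_le_mul_right r h1
      rw [mul_comm] at h4
      omega
    have hterm : ∀ i ∈ J, ρ i + δ - 1 - ρ i = δ - 1 := fun i _ => by omega
    rw [sum_congr rfl hterm, sum_const, smul_eq_mul]
    have h3 : #J * (δ - 1) ≤ K * (δ - 1) := Nat.mul_le_mul_right _ hJK
    have h4 : ((K * (δ - 1) : ℕ) : ℤ) = (K : ℤ) * (δ - 1) := by
      rw [Nat.cast_mul, Nat.cast_sub hδ]
      push_cast
      ring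
    rw [← h4]
    omega

end Parameters

/-! ### Parameter arithmetic and the main theorem -/

theorem ceil_div_bounds {x y : ℤ} (hy : 0 < y) :
    y * (⌈(x : ℚ) / y⌉ - 1) < x ∧ x ≤ y * ⌈(x : ℚ) / y⌉ := by
  have hy' : (0 : ℚ) < y := by exact_mod_cast hy
  have h1 := Int.le_ceil ((x : ℚ) / y)
  have h2 := Int.ceil_lt_add_one ((x : ℚ) / y)
  rw [div_le_iff₀ hy'] at h1
  rw [← sub_lt_iff_lt_add, lt_div_iff₀ hy'] at h2
  rw [mul_comm y, mul_comm y]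
  exact ⟨by exact_mod_cast h2, by exact_mod_cast h1⟩

theorem theorem4p2 (n k r δ : ℕ) (a b m v K q : ℤ)
    (hK : K = ⌈(k : ℚ) / (r : ℚ)⌉)
    (ha : a = r * K - k)
    (hb : b = ((r : ℤ) + δ - 1) * ⌈(n : ℚ) / ((r : ℚ) + δ - 1)⌉ - n)
    (hm : m = ⌈(n : ℚ) / ((r : ℚ) + δ - 1)⌉ - 1)
    (hq : q = ⌊((r : ℚ) + δ - 1 - b) / (m : ℚ)⌋)
    (hv : v = (r : ℤ) + δ - 1 - b - q * m)
    (hr : 0 < r) (hrk : r < k) (hkn : (k : ℤ) ≤ n - K * ((δ : ℤ) - 1))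
    (hδ : 2 ≤ δ) (hab : a < b) :
    -- the maximal minimum distance exists
    IsGreatest (linearLRCDistances n k r δ) (linearLRCDMax n k r δ) ∧
    -- the two lower bounds
    ((δ : ℤ) - 1 ≤ (K - 1) * q + min v (K - 1) →
      (linearLRCDMax n k r δ : ℤ) ≥ n - k + 1 - K * ((δ : ℤ) - 1)) ∧
    ((δ : ℤ) - 1 > (K - 1) * q + min v (K - 1) →
      (linearLRCDMax n k r δ : ℤ) ≥
        n - k + 1 - min v (K - 1) - (K - 1) * (q + (δ : ℤ) - 1)) ∧
    -- the comparison of the new bound with the old one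
    ((n : ℤ) - k + 1 - min v (K - 1) - (K - 1) * (q + (δ : ℤ) - 1))
        - ((n : ℤ) - k + 1 - K * ((δ : ℤ) - 1) + (b - r)) ≥ q * (m - K + 1) ∧
    q * (m - K + 1) ≥ 0 := by
  have hrz : (0 : ℤ) < r := by exact_mod_cast hr
  have hLz : (0 : ℤ) < r + δ - 1 := by omega
  obtain ⟨hK1, hK2⟩ : r * (K - 1) < k ∧ (k : ℤ) ≤ r * K := by
    have := ceil_div_bounds (x := k) hrz
    push_cast at this
    rwa [← hK] at this
  obtain ⟨hm1, hm2⟩ : ((r : ℤ) + δ - 1) * m < n ∧ (n : ℤ) ≤ (r + δ - 1) * (m + 1) := by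
    have := ceil_div_bounds (x := n) hLz
    push_cast at this
    rwa [← hm, show ⌈(n : ℚ) / ((r : ℚ) + δ - 1)⌉ = m + 1 by omega] at this
  replace hb : b = ((r : ℤ) + δ - 1) * (m + 1) - n := by rw [hb, hm]; ring
  have hKpos : 2 ≤ K := by nlinarith
  have hKm : K ≤ m := by
    -- If `m + 1 ≤ K`, then `b ≤ (r + δ - 1) * K - n ≤ r * K - k = a`, against `a < b`.
    by_contra! h
    have := mul_le_mul_of_nonneg_left (show m + 1 ≤ K by omega) hLz.le
    nlinarith
  have hm0 : 0 < m := by omega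
  have hbL : 0 < (r : ℤ) + δ - 1 - b := by
    rw [hb]
    linarith
  have hqf : q = ((r : ℤ) + δ - 1 - b) / m := by
    rw [hq, Int.floor_div_cast_of_nonneg hm0.le]
    congr 1
    exact_mod_cast Int.floor_intCast (R := ℚ) ((r : ℤ) + δ - 1 - b)
  have hvm : v = ((r : ℤ) + δ - 1 - b) % m := by
    rw [hv, hqf, Int.emod_def]
    ring
  have hq0 : 0 ≤ q := hqf ▸ Int.ediv_nonneg hbL.le hm0.le
  have hv0 : 0 ≤ v := hvm ▸ Int.emod_nonneg _ hm0.ne'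
  have hvlt : v < m := hvm ▸ Int.emod_lt_of_pos _ hm0
  clear hK hm hq hqf hvm
  have hprod : 0 ≤ q * (m - K + 1) := mul_nonneg hq0 (by omega)
  have hmin : min v (K - 1) ≤ v := min_le_left _ _
  lift K to ℕ using by omega
  lift m to ℕ using hm0.le
  lift q to ℕ using hq0
  lift v to ℕ using hv0
  obtain ⟨d, hd, hdnew⟩ := exists_mem_linearLRCDistances_of_equal_ranks (n := n) (δ := δ)
    (q := q) (v := v) (m := m) (K := K) (hr.trans hrk) hr (by omega) (by exact_mod_cast hK2)
    (by omega) (by omega) (by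
      zify [show 1 ≤ r + δ by omega]
      linear_combination hv - hb)
  have hgreat := isGreatest_linearLRCDMax ⟨d, hd⟩
  have hnew : (d : ℤ) ≤ linearLRCDMax n k r δ := by exact_mod_cast hgreat.2 hd
  refine ⟨hgreat, fun hcase => ?_, fun _ => hdnew.trans hnew, by linarith, hprod⟩
  -- After `m` full clusters, `r + δ - 1 - b` coordinates remain: enough for dimension `e = r - b >
  -- 0` and distance `δ` exactly when `b < r`. Otherwise the old bound is at least the target and
  -- the new one dominates it.
  rcases lt_or_ge b r with hbr | hbr
  · obtain ⟨e, he⟩ := Int.eq_ofNat_of_zero_le (sub_nonneg.2 hbr.le)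
    obtain ⟨d', hd', hle⟩ := exists_mem_linearLRCDistances_of_short_cluster (n := n) (δ := δ)
      (e := e) (m := m) (K := K) (r := r) (hr.trans hrk) (by omega) (by omega)
      (by nlinarith) (by exact_mod_cast hK2) (by omega) (by
        zify [show 1 ≤ r + δ by omega, show 1 ≤ e + δ by omega]
        linear_combination -hb - he)
    exact hle.trans (by exact_mod_cast hgreat.2 hd')
  · refine le_trans ?_ (hdnew.trans hnew)
    linarith
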